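/- Let $X$ be a proper CAT(0) space that is cocompact (the translates of some compact subset under the full isometry group of $X$ cover $X$). Fix a basepoint $x_0\in X$ and a non-principal ultrafilter $\omega$ on $\mathbb N$. \emph{Conventions.} The ultraproduct $\prod^\omega_e X_n$ of metric spaces $(X_n,d_{X_n})$ with observation sequence $e=(e_n)$, $e_n\in X_n$, is the set of sequences $(x_n)$ with $\sup_n d_{X_n}(x_n,e_n)<\infty$, with metric $\lim^\omega d_{X_n}(x_n,y_n)$, sequences at distance $0$ being identified. A scaling sequence is a sequence $d=(d_n)$ of positive reals with $\lim^\omega d_n=\infty$; write $d'\preceq d$ if $d'_n\le d_n$ for $\omega$-almost every $n$. The asymptotic cone $\mathrm{Con}^\omega(X,(x_0),d)$ is the ultraproduct of the spaces $(X,d_X/d_n)$ with constant observation sequence $(x_0)$. For $x\in X$ and $t\ge 0$ let $\Xi(x,t)$ be $x$ if $d_X(x_0,x)\le t$, and otherwise the point at distance $t$ from $x_0$ on the geodesic $[x_0,x]$. For $d'\preceq d$ the connecting map $\Theta^d_{d'}:\mathrm{Con}^\omega(X,(x_0),d)\to\mathrm{Con}^\omega(X,(x_0),d')$ is $$\Theta^d_{d'}\bigl((x_n)\bigr)=\Bigl(\Xi\bigl(x_n,\tfrac{d'_n}{d_n}d_X(x_n,x_0)\bigr)\Bigr).$$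 The inverse limit $L=\varprojlim\bigl(\mathrm{Con}^\omega(X,(x_0),d),\Theta^d_{d'}\bigr)$ is the set of families $(x^d)_d$, indexed by all scaling sequences $d$, with $x^d\in\mathrm{Con}^\omega(X,(x_0),d)$ and $\Theta^d_{d'}(x^d)=x^{d'}$ whenever $d'\preceq d$; it carries the (a priori extended) metric $\rho\bigl((x^d),(y^d)\bigr)=\sup_d\,\mathrm{dist}(x^d,y^d)$. Let $\partial_\angle X$ be the set of geodesic rays from $x_0$ with the angle metric $\angle(\alpha,\beta)=\lim_{t\to\infty}\overline\angle_{x_0}(\alpha(t),\beta(t))$, where $\overline\angle$ is the Euclidean comparison angle, and let $\partial^\omega_\angle X=\prod^\omega_e\partial_\angle X$ (independent of $e$). For a metric space $Y$, $\mathrm{cone}(Y)$ is $[0,\infty)\times Y$ with all points $(0,y)$ identified, and with the metric $$\mathrm{dist}\bigl((s,y),(t,z)\bigr)^2=s^2+t^2-2st\cos\bigl(\min\{\pi,d_Y(y,z)\}\bigr).$$ For a scaling sequence $d$ let $\Psi^\omega_d:\mathrm{cone}(\partial^\omega_\angle X)\to\mathrm{Con}^\omega(X,(x_0),d)$, $\Psi^\omega_d\bigl(t,(\alpha_n)\bigr)=\bigl(\alpha_n(td_n)\bigr)$.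 \textbf{Theorem.} The metric $\rho$ is finite, and $(L,\rho)$ is a complete metric space. Moreover, for every $u\in\mathrm{cone}(\partial^\omega_\angle X)$ the family $\bigl(\Psi^\omega_d(u)\bigr)_d$ belongs to $L$, and the map $u\mapsto\bigl(\Psi^\omega_d(u)\bigr)_d$ is an isometric embedding of $\mathrm{cone}(\partial^\omega_\angle X)$ into $L$. -/

import Mathlib

open Filter Topology
open scoped NNReal ENNReal

/-! ## CAT(0) spaces -/

/-- A CAT(0) space: a geodesic metric space all of whose geodesic triangles are at least as thin as
their comparison triangles in the Euclidean plane. In a geodesic space, `p` lies on a geodesic from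
`x` to `y` iff `dist x p + dist p y = dist x y`, so `thin` compares a point `p` of a side from `x`
to `y` and a point `q` of a side from `x` to `z` with their comparison points `p'` and `q'`.
(Two points on one side are covered by it too, with `y = z`; it also makes geodesics unique.) -/
class CAT0Space (X : Type*) [MetricSpace X] : Prop where
  geodesic : ∀ x y : X, ∃ γ : ℝ → X, γ 0 = x ∧ γ (dist x y) = y ∧
    ∀ s ∈ Set.Icc 0 (dist x y), ∀ t ∈ Set.Icc 0 (dist x y), dist (γ s) (γ t) = |s - t|
  thin : ∀ (x y z p q : X) (x' y' z' p' q' : EuclideanSpace ℝ (Fin 2)),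
    dist x' y' = dist x y → dist x' z' = dist x z → dist y' z' = dist y z →
    dist x p + dist p y = dist x y → dist x' p' = dist x p → dist p' y' = dist p y →
    dist x q + dist q z = dist x z → dist x' q' = dist x q → dist q' z' = dist q z →
    dist p q ≤ dist p' q'

/-- A metric space is cocompact if the translates of some compact set under the full isometry group
cover it. -/
def IsCocompactSpace (X : Type*) [MetricSpace X] : Prop :=
  ∃ K : Set X, IsCompact K ∧ ∀ x : X, ∃ g : X ≃ᵢ X, ∃ k ∈ K, g k = x

/-! ## Comparison angles -/

/-- The comparison angle at `p` between `x` and `y`, by the Euclidean law of cosines. It is only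
used for `x ≠ p` and `y ≠ p`. -/
noncomputable def compAngle {X : Type*} [MetricSpace X] (p x y : X) : ℝ :=
  Real.arccos ((dist p x ^ 2 + dist p y ^ 2 - dist x y ^ 2) / (2 * dist p x * dist p y))

/-- The point of the Euclidean plane with polar coordinates `r`, `θ`. -/
noncomputable def planePt (r θ : ℝ) : EuclideanSpace ℝ (Fin 2) :=
  !₂[r * Real.cos θ, r * Real.sin θ]

theorem dist_planePt (r s θ φ : ℝ) :
    dist (planePt r θ) (planePt s φ) =
      √(r ^ 2 + s ^ 2 - 2 * r * s * Real.cos (θ - φ)) := by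
  rw [EuclideanSpace.dist_eq]
  congr 1
  simp only [planePt, Fin.sum_univ_two, Real.dist_eq, sq_abs, Real.cos_sub]
  simp
  linear_combination r ^ 2 * Real.sin_sq_add_cos_sq θ + s ^ 2 * Real.sin_sq_add_cos_sq φ

theorem dist_planePt_same (r s θ : ℝ) : dist (planePt r θ) (planePt s θ) = |r - s| := by
  rw [dist_planePt, ← Real.sqrt_sq_eq_abs]
  congr 1
  simp
  ring

section CompAngle

variable {X : Type*} [MetricSpace X]

theorem compAngle_nonneg (p x y : X) : 0 ≤ compAngle p x y := Real.arccos_nonneg _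

theorem compAngle_le_pi (p x y : X) : compAngle p x y ≤ Real.pi := Real.arccos_le_pi _

theorem compAngle_comm (p x y : X) : compAngle p x y = compAngle p y x := by
  unfold compAngle
  rw [dist_comm x y]
  congr 1
  ring

theorem dist_sq_eq_compAngle {p x y : X} (hx : 0 < dist p x) (hy : 0 < dist p y) :
    dist x y ^ 2 = dist p x ^ 2 + dist p y ^ 2
      - 2 * dist p x * dist p y * Real.cos (compAngle p x y) := by
  have h1 := dist_triangle_left x y p
  have h2 := dist_triangle p x y
  have h3 := dist_triangle p y x
  rw [dist_comm y x] at h3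
  have h0 : 0 < 2 * dist p x * dist p y := by positivity
  unfold compAngle
  rw [Real.cos_arccos]
  · field_simp
    ring
  · rw [le_div_iff₀ h0]
    nlinarith [dist_nonneg (x := x) (y := y)]
  · rw [div_le_one h0]
    nlinarith [dist_nonneg (x := x) (y := y)]

theorem exists_dist_sq_eq (p x y : X) : ∃ θ : ℝ,
    dist x y ^ 2 = dist p x ^ 2 + dist p y ^ 2 - 2 * dist p x * dist p y * Real.cos θ := by
  rcases (dist_nonneg (x := p) (y := x)).eq_or_lt with hx | hx
  · refine ⟨0, ?_⟩
    rw [dist_eq_zero.1 hx.symm]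
    simp
  rcases (dist_nonneg (x := p) (y := y)).eq_or_lt with hy | hy
  · refine ⟨0, ?_⟩
    rw [dist_eq_zero.1 hy.symm, dist_comm x y]
    simp
  exact ⟨_, dist_sq_eq_compAngle hx hy⟩

theorem compAngle_le_of_dist_sq_le {p x y : X} (hx : 0 < dist p x) (hy : 0 < dist p y) {θ : ℝ}
    (h0 : 0 ≤ θ) (hπ : θ ≤ Real.pi)
    (h : dist x y ^ 2 ≤ dist p x ^ 2 + dist p y ^ 2 - 2 * dist p x * dist p y * Real.cos θ) :
    compAngle p x y ≤ θ := by
  rw [← Real.arccos_cos h0 hπ]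
  apply Real.arccos_le_arccos
  have : 0 < 2 * dist p x * dist p y := by positivity
  rw [le_div_iff₀ this]
  linarith

theorem dist_sq_le_of_compAngle_le {p x y : X} (hx : 0 < dist p x) (hy : 0 < dist p y) {θ : ℝ}
    (hπ : θ ≤ Real.pi) (h : compAngle p x y ≤ θ) :
    dist x y ^ 2 ≤ dist p x ^ 2 + dist p y ^ 2 - 2 * dist p x * dist p y * Real.cos θ := by
  rw [dist_sq_eq_compAngle hx hy]
  have := Real.cos_le_cos_of_nonneg_of_le_pi (compAngle_nonneg p x y) hπ h
  have h2 : 0 < 2 * dist p x * dist p y := by positivity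
  nlinarith

variable [CAT0Space X]

theorem CAT0Space.dist_sq_le {o x y p q : X} {θ : ℝ}
    (hθ : dist x y ^ 2 = dist o x ^ 2 + dist o y ^ 2 - 2 * dist o x * dist o y * Real.cos θ)
    (hp : dist o p + dist p x = dist o x) (hq : dist o q + dist q y = dist o y) :
    dist p q ^ 2 ≤ dist o p ^ 2 + dist o q ^ 2 - 2 * dist o p * dist o q * Real.cos θ := by
  have h := CAT0Space.thin o x y p q (planePt 0 0) (planePt (dist o x) θ) (planePt (dist o y) 0)
    (planePt (dist o p) θ) (planePt (dist o q) 0)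
    (by rw [dist_planePt]; simp) (by rw [dist_planePt]; simp)
    (by rw [dist_planePt, sub_zero, ← hθ, Real.sqrt_sq dist_nonneg])
    hp (by rw [dist_planePt]; simp)
    (by rw [dist_planePt_same, abs_sub_comm, ← hp]; simp)
    hq (by rw [dist_planePt]; simp)
    (by rw [dist_planePt_same, abs_sub_comm, ← hq]; simp)
  rw [dist_planePt, sub_zero] at h
  have h0 : 0 ≤ dist o p ^ 2 + dist o q ^ 2 - 2 * dist o p * dist o q * Real.cos θ := by
    have := mul_nonneg (mul_nonneg (dist_nonneg (x := o) (y := p)) (dist_nonneg (x := o) (y := q)))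
      (sub_nonneg.2 (Real.cos_le_one θ))
    nlinarith [sq_nonneg (dist o p - dist o q)]
  exact (Real.le_sqrt dist_nonneg h0).1 h

/-- Points dividing two geodesics from `o` in the same ratio `c`. -/
theorem CAT0Space.dist_le_mul {o x y p q : X} {c : ℝ} (hc : 0 ≤ c)
    (hp : dist o p + dist p x = dist o x) (hq : dist o q + dist q y = dist o y)
    (hpc : dist o p = c * dist o x) (hqc : dist o q = c * dist o y) :
    dist p q ≤ c * dist x y := by
  obtain ⟨θ, hθ⟩ := exists_dist_sq_eq o x y
  have h := CAT0Space.dist_sq_le hθ hp hq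
  refine abs_le_of_sq_le_sq' ?_ (by positivity) |>.2
  rw [mul_pow, hθ]
  rw [hpc, hqc] at h
  linarith

end CompAngle

/-! ## The boundary and the angle metric -/

/-- A point of the boundary `∂X`: a geodesic ray issuing from the basepoint `x₀`. -/
structure BoundaryRay {X : Type*} [MetricSpace X] (x₀ : X) where
  toFun : ℝ≥0 → X
  isometry : Isometry toFun
  map_zero : toFun 0 = x₀

namespace BoundaryRay

variable {X : Type*} [MetricSpace X] {x₀ : X}

instance : CoeFun (BoundaryRay x₀) (fun _ => ℝ≥0 → X) := ⟨toFun⟩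

theorem dist_apply (α : BoundaryRay x₀) (s t : ℝ≥0) : dist (α s) (α t) = |(s : ℝ) - t| := by
  rw [α.isometry.dist_eq, NNReal.dist_eq]

theorem dist_base (α : BoundaryRay x₀) (t : ℝ≥0) : dist x₀ (α t) = t := by
  have := α.dist_apply 0 t
  rw [α.map_zero] at this
  simpa using this

theorem dist_add (α : BoundaryRay x₀) {s t : ℝ≥0} (h : s ≤ t) :
    dist x₀ (α s) + dist (α s) (α t) = dist x₀ (α t) := by
  have : (s : ℝ) ≤ t := h
  rw [α.dist_apply, α.dist_base, α.dist_base, abs_of_nonpos (by linarith)]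
  ring

/-- The angle `∠(α, β)`: the limit of the comparison angles at `x₀` between `α t` and `β t`,
as `t → ∞`. -/
noncomputable def angle (α β : BoundaryRay x₀) : ℝ :=
  limUnder atTop (fun t : ℝ≥0 => compAngle x₀ (α t) (β t))

variable [CAT0Space X]

theorem compAngle_mono (α β : BoundaryRay x₀) {s s' t t' : ℝ≥0} (hs : 0 < s) (ht : 0 < t)
    (hss : s ≤ s') (htt : t ≤ t') :
    compAngle x₀ (α s) (β t) ≤ compAngle x₀ (α s') (β t') := by
  have hs0 : 0 < dist x₀ (α s) := by rw [dist_base]; exact hs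
  have ht0 : 0 < dist x₀ (β t) := by rw [dist_base]; exact ht
  have hs0' : 0 < dist x₀ (α s') := by rw [dist_base]; exact hs.trans_le hss
  have ht0' : 0 < dist x₀ (β t') := by rw [dist_base]; exact ht.trans_le htt
  exact compAngle_le_of_dist_sq_le hs0 ht0 (compAngle_nonneg _ _ _) (compAngle_le_pi _ _ _)
    (CAT0Space.dist_sq_le (dist_sq_eq_compAngle hs0' ht0') (α.dist_add hss) (β.dist_add htt))

theorem tendsto_angle (α β : BoundaryRay x₀) :
    Tendsto (fun t : ℝ≥0 => compAngle x₀ (α t) (β t)) atTop (𝓝 (angle α β)) := by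
  apply tendsto_nhds_limUnder
  let g : ℝ≥0 → ℝ := fun t => if t = 0 then 0 else compAngle x₀ (α t) (β t)
  have hg : Monotone g := by
    intro s t hst
    rcases eq_or_ne s 0 with rfl | hs
    · simp only [g, if_true]
      split_ifs
      · exact le_rfl
      · exact compAngle_nonneg _ _ _
    · have hs' : 0 < s := pos_iff_ne_zero.2 hs
      have ht' : 0 < t := hs'.trans_le hst
      simp only [g, if_neg hs, if_neg ht'.ne']
      exact compAngle_mono α β hs' hs' hst hst
  have hb : BddAbove (Set.range g) := by
    refine ⟨Real.pi, ?_⟩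
    rintro _ ⟨t, rfl⟩
    simp only [g]
    split_ifs
    · exact Real.pi_pos.le
    · exact compAngle_le_pi _ _ _
  refine ⟨_, (tendsto_atTop_ciSup hg hb).congr' ?_⟩
  filter_upwards [eventually_gt_atTop (0 : ℝ≥0)] with t ht
  simp [g, ht.ne']

theorem compAngle_le_angle (α β : BoundaryRay x₀) {s t : ℝ≥0} (hs : 0 < s) (ht : 0 < t) :
    compAngle x₀ (α s) (β t) ≤ angle α β := by
  refine ge_of_tendsto (tendsto_angle α β) ?_
  filter_upwards [eventually_ge_atTop s, eventually_ge_atTop t] with r hrs hrt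
  exact compAngle_mono α β hs ht hrs hrt

theorem angle_nonneg (α β : BoundaryRay x₀) : 0 ≤ angle α β :=
  ge_of_tendsto' (tendsto_angle α β) fun _ => compAngle_nonneg _ _ _

theorem angle_le_pi (α β : BoundaryRay x₀) : angle α β ≤ Real.pi :=
  le_of_tendsto' (tendsto_angle α β) fun _ => compAngle_le_pi _ _ _

theorem dist_le_mul_angle (α β : BoundaryRay x₀) (t : ℝ≥0) :
    dist (α t) (β t) ≤ t * angle α β := by
  rcases eq_or_ne t 0 with rfl | ht
  · simp [α.map_zero, β.map_zero]
  have ht : 0 < t := pos_iff_ne_zero.2 ht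
  have h := dist_sq_le_of_compAngle_le (p := x₀) (x := α t) (y := β t)
    (by rw [dist_base]; exact ht) (by rw [dist_base]; exact ht)
    (angle_le_pi α β) (compAngle_le_angle α β ht ht)
  rw [dist_base, dist_base] at h
  refine abs_le_of_sq_le_sq' ?_ (mul_nonneg t.coe_nonneg (angle_nonneg α β)) |>.2
  have := mul_le_mul_of_nonneg_left (Real.one_sub_sq_div_two_le_cos (x := angle α β))
    (sq_nonneg (t : ℝ))
  rw [mul_pow]
  linarith

theorem angle_self (α : BoundaryRay x₀) : angle α α = 0 := by
  refine tendsto_nhds_unique (tendsto_angle α α) (tendsto_const_nhds.congr' ?_)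
  filter_upwards [eventually_gt_atTop (0 : ℝ≥0)] with t ht
  have : (t : ℝ) ≠ 0 := by exact_mod_cast ht.ne'
  simp only [compAngle, dist_base, dist_self]
  rw [show ((t : ℝ) ^ 2 + t ^ 2 - 0 ^ 2) / (2 * t * t) = 1 by field_simp; ring, Real.arccos_one]

theorem angle_comm (α β : BoundaryRay x₀) : angle α β = angle β α :=
  tendsto_nhds_unique (tendsto_angle α β)
    ((tendsto_angle β α).congr fun _ => compAngle_comm _ _ _)

theorem angle_triangle (α β γ : BoundaryRay x₀) : angle α γ ≤ angle α β + angle β γ := by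
  refine le_of_tendsto (tendsto_angle α γ) ?_
  filter_upwards [eventually_gt_atTop (0 : ℝ≥0)] with t ht
  rcases le_or_gt Real.pi (angle α β + angle β γ) with hπ | hπ
  · exact (compAngle_le_pi _ _ _).trans hπ
  set a := angle α β with ha
  set b := angle β γ with hb
  have ha0 : 0 ≤ a := angle_nonneg _ _
  have hb0 : 0 ≤ b := angle_nonneg _ _
  set m := (a + b) / 2 with hm
  set δ := (a - b) / 2 with hδ
  have haa : a = m + δ := by rw [hm, hδ]; ring
  have hbb : b = m - δ := by rw [hm, hδ]; ring
  have hcm : 0 < Real.cos m := Real.cos_pos_of_mem_Ioo ⟨by linarith, by linarith⟩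
  have hcδ : 0 < Real.cos δ := Real.cos_pos_of_mem_Ioo ⟨by linarith, by linarith⟩
  have hsa : 0 ≤ Real.sin a := Real.sin_nonneg_of_nonneg_of_le_pi ha0 (by linarith)
  have hsb : 0 ≤ Real.sin b := Real.sin_nonneg_of_nonneg_of_le_pi hb0 (by linarith)
  have htR : (0 : ℝ) < t := ht
  set s : ℝ≥0 := ⟨t * Real.cos m / Real.cos δ, by positivity⟩ with hs
  have hsv : (s : ℝ) = t * Real.cos m / Real.cos δ := rfl
  have hs0 : 0 < s := by
    have : (0 : ℝ) < s := by rw [hsv]; positivity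
    exact this
  have h1 := dist_sq_le_of_compAngle_le (p := x₀) (x := α t) (y := β s)
    (by rw [dist_base]; exact ht) (by rw [dist_base]; exact hs0)
    (angle_le_pi α β) (compAngle_le_angle α β ht hs0)
  have h2 := dist_sq_le_of_compAngle_le (p := x₀) (x := β s) (y := γ t)
    (by rw [dist_base]; exact hs0) (by rw [dist_base]; exact ht)
    (angle_le_pi β γ) (compAngle_le_angle β γ hs0 ht)
  rw [dist_base, dist_base, ← ha, hsv] at h1
  rw [dist_base, dist_base, ← hb, hsv] at h2
  have e1 := Real.sin_sq_add_cos_sq m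
  have e2 := Real.sin_sq_add_cos_sq δ
  have k1 : dist (α t) (β s) ≤ t * Real.sin a / Real.cos δ := by
    refine abs_le_of_sq_le_sq' (h1.trans_eq ?_) (by positivity) |>.2
    rw [haa, Real.sin_add, Real.cos_add]
    field_simp
    linear_combination (-Real.cos δ ^ 2) * e1 - Real.cos m ^ 2 * e2
  have k2 : dist (β s) (γ t) ≤ t * Real.sin b / Real.cos δ := by
    refine abs_le_of_sq_le_sq' (h2.trans_eq ?_) (by positivity) |>.2
    rw [hbb, Real.sin_sub, Real.cos_sub]
    field_simp
    linear_combination (-Real.cos δ ^ 2) * e1 - Real.cos m ^ 2 * e2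
  have k3 : dist (α t) (γ t) ≤ 2 * t * Real.sin m := by
    refine (dist_triangle _ (β s) _).trans ((add_le_add k1 k2).trans_eq ?_)
    rw [haa, hbb, Real.sin_add, Real.sin_sub]
    field_simp
    ring
  apply compAngle_le_of_dist_sq_le (by rw [dist_base]; exact ht) (by rw [dist_base]; exact ht)
    (by linarith) hπ.le
  rw [dist_base, dist_base, show a + b = 2 * m by rw [hm]; ring, Real.cos_two_mul]
  have := pow_le_pow_left₀ dist_nonneg k3 2
  nlinarith

theorem eq_of_angle_eq_zero {α β : BoundaryRay x₀} (h : angle α β = 0) : α = β := by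
  have : α.toFun = β.toFun := by
    funext t
    have := dist_le_mul_angle α β t
    rw [h, mul_zero] at this
    exact dist_le_zero.1 this
  cases α
  cases β
  simpa using this

/-- The angle boundary: `∂X` with the angle metric. -/
noncomputable instance : MetricSpace (BoundaryRay x₀) where
  dist := angle
  dist_self := angle_self
  dist_comm := angle_comm
  dist_triangle := angle_triangle
  eq_of_dist_eq_zero := eq_of_angle_eq_zero

end BoundaryRay

/-! ## Ultraproducts of metric spaces -/

/-- Sequences at uniformly bounded distance from the observation sequence `e`. -/
structure ObservedSeq {E : ℕ → Type*} [∀ n, MetricSpace (E n)] (ω : Ultrafilter ℕ)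
    (e : ∀ n, E n) where
  seq : ∀ n, E n
  bounded : ∃ C : ℝ, ∀ n, dist (seq n) (e n) ≤ C

namespace ObservedSeq

variable {E : ℕ → Type*} [∀ n, MetricSpace (E n)] {ω : Ultrafilter ℕ} {e : ∀ n, E n}

/-- The ultralimit of the distances. -/
noncomputable def udist (x y : ObservedSeq ω e) : ℝ :=
  limUnder (ω : Filter ℕ) (fun n => dist (x.seq n) (y.seq n))

theorem tendsto_udist (x y : ObservedSeq ω e) :
    Tendsto (fun n => dist (x.seq n) (y.seq n)) ω (𝓝 (udist x y)) := by
  apply tendsto_nhds_limUnder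
  obtain ⟨C, hC⟩ := x.bounded
  obtain ⟨D, hD⟩ := y.bounded
  have hK : IsCompact (Set.Icc (0 : ℝ) (C + D)) := isCompact_Icc
  obtain ⟨l, -, hl⟩ := hK.ultrafilter_le_nhds (ω.map fun n => dist (x.seq n) (y.seq n)) (by
    rw [le_principal_iff]
    refine Ultrafilter.mem_map.2 (Filter.univ_mem' fun n => ⟨dist_nonneg, ?_⟩)
    exact (dist_triangle_right _ _ (e n)).trans (add_le_add (hC n) (hD n)))
  exact ⟨l, hl⟩

noncomputable instance : PseudoMetricSpace (ObservedSeq ω e) where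
  dist := udist
  dist_self x := tendsto_nhds_unique (tendsto_udist x x) (by simp)
  dist_comm x y := tendsto_nhds_unique (tendsto_udist x y)
    ((tendsto_udist y x).congr fun _ => dist_comm _ _)
  dist_triangle x y z := le_of_tendsto_of_tendsto' (tendsto_udist x z)
    ((tendsto_udist x y).add (tendsto_udist y z)) fun _ => dist_triangle _ _ _

theorem tendsto_dist (x y : ObservedSeq ω e) :
    Tendsto (fun n => dist (x.seq n) (y.seq n)) ω (𝓝 (dist x y)) :=
  tendsto_udist x y

end ObservedSeq

/-- The ultraproduct of the metric spaces `E n` with observation sequence `e`: the observed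
sequences, identified when the ultralimit of their distances is zero, with the induced metric. -/
abbrev Ultraproduct {E : ℕ → Type*} [∀ n, MetricSpace (E n)] (ω : Ultrafilter ℕ)
    (e : ∀ n, E n) : Type _ :=
  SeparationQuotient (ObservedSeq ω e)

/-- The class of an observed sequence. -/
noncomputable def Ultraproduct.mk {E : ℕ → Type*} [∀ n, MetricSpace (E n)] {ω : Ultrafilter ℕ} {e : ∀ n, E n}
    (x : ObservedSeq ω e) : Ultraproduct ω e :=
  SeparationQuotient.mk x

/-! ## Asymptotic cones -/

/-- The metric space `(X, dist / c)`, for `c > 0`. -/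
structure Rescaled (X : Type*) (c : {c : ℝ≥0 // 0 < c}) where
  pt : X

noncomputable instance {X : Type*} [MetricSpace X] (c : {c : ℝ≥0 // 0 < c}) :
    MetricSpace (Rescaled X c) where
  dist x y := dist x.pt y.pt / (c : ℝ≥0)
  dist_self x := by simp
  dist_comm x y := by simp only [dist_comm]
  dist_triangle x y z := by
    rw [← add_div]
    exact div_le_div_of_nonneg_right (dist_triangle x.pt y.pt z.pt) (c : ℝ≥0).2
  eq_of_dist_eq_zero {x y} h := by
    have hc : ((c : ℝ≥0) : ℝ) ≠ 0 := by exact_mod_cast c.2.ne'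
    have := dist_eq_zero.1 ((div_eq_zero_iff.1 h).resolve_right hc)
    cases x
    cases y
    simpa using this

theorem Rescaled.dist_def {X : Type*} [MetricSpace X] {c : {c : ℝ≥0 // 0 < c}}
    (x y : Rescaled X c) : dist x y = dist x.pt y.pt / (c : ℝ≥0) := rfl

/-- A scaling sequence: a sequence of positive reals diverging (to `∞`) along `ω`. -/
structure ScalingSeq (ω : Ultrafilter ℕ) where
  val : ℕ → {c : ℝ≥0 // 0 < c}
  diverges : Tendsto (fun n => ((val n : ℝ≥0) : ℝ)) ω atTop

/-- `d' ≤ d` if `d' n ≤ d n` for `ω`-almost every `n`. -/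
instance (ω : Ultrafilter ℕ) : Preorder (ScalingSeq ω) where
  le d' d := ∀ᶠ n in (ω : Filter ℕ), d'.val n ≤ d.val n
  le_refl _ := Eventually.of_forall fun _ => le_rfl
  le_trans _ _ _ h₁ h₂ := by
    filter_upwards [h₁, h₂] with n using le_trans

/-- Sequences `x` in `X` with `dist (x n) x₀ / d n` bounded. -/
abbrev ConeSeq {X : Type*} [MetricSpace X] {ω : Ultrafilter ℕ} (x₀ : X) (d : ScalingSeq ω) :
    Type _ :=
  ObservedSeq (E := fun n => Rescaled X (d.val n)) ω (fun _ => ⟨x₀⟩)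

/-- The asymptotic cone of `X` with constant observation sequence `x₀` and scaling sequence `d`:
the ultraproduct of the spaces `(X, dist / d n)`. -/
abbrev AsymptoticCone {X : Type*} [MetricSpace X] {ω : Ultrafilter ℕ} (x₀ : X)
    (d : ScalingSeq ω) : Type _ :=
  Ultraproduct (E := fun n => Rescaled X (d.val n)) ω (fun _ => ⟨x₀⟩)

/-! ## The connecting maps -/

section Retraction

variable {X : Type*} [MetricSpace X] [CAT0Space X]

theorem exists_geodesic_point (x₀ x : X) (t : ℝ≥0) (h : t < dist x₀ x) :
    ∃ y : X, dist x₀ y = t ∧ dist x₀ y + dist y x = dist x₀ x := by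
  obtain ⟨γ, h0, h1, hγ⟩ := CAT0Space.geodesic x₀ x
  have m0 : (0 : ℝ) ∈ Set.Icc 0 (dist x₀ x) := ⟨le_rfl, dist_nonneg⟩
  have m1 : dist x₀ x ∈ Set.Icc 0 (dist x₀ x) := ⟨dist_nonneg, le_rfl⟩
  have mt : (t : ℝ) ∈ Set.Icc 0 (dist x₀ x) := ⟨t.2, h.le⟩
  have e1 := hγ 0 m0 t mt
  have e2 := hγ t mt _ m1
  rw [h0] at e1
  rw [h1] at e2
  have e3 : dist x₀ (γ t) = t := by rw [e1]; simp
  refine ⟨γ t, e3, ?_⟩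
  rw [e3, e2, abs_of_neg (by linarith)]
  ring

open Classical in
/-- The geodesic retraction `Ξ(x, t)` of `X` onto the closed ball of radius `t` about `x₀`: `x` if
`dist x₀ x ≤ t`, and otherwise the point of the geodesic from `x₀` to `x` at distance `t` from
`x₀`. -/
noncomputable def geodRetract (x₀ x : X) (t : ℝ≥0) : X :=
  if h : t < dist x₀ x then Classical.choose (exists_geodesic_point x₀ x t h) else x

theorem dist_geodRetract (x₀ x : X) (t : ℝ≥0) :
    dist x₀ (geodRetract x₀ x t) = min (t : ℝ) (dist x₀ x) := by
  unfold geodRetract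
  split_ifs with h
  · rw [(Classical.choose_spec (exists_geodesic_point x₀ x t h)).1, min_eq_left h.le]
  · rw [min_eq_right (not_lt.1 h)]

theorem dist_geodRetract_add (x₀ x : X) (t : ℝ≥0) :
    dist x₀ (geodRetract x₀ x t) + dist (geodRetract x₀ x t) x = dist x₀ x := by
  unfold geodRetract
  split_ifs with h
  · exact (Classical.choose_spec (exists_geodesic_point x₀ x t h)).2
  · simp

theorem dist_geodRetract_ratio (x₀ x : X) {c' c : {c : ℝ≥0 // 0 < c}} (h : c' ≤ c) :
    dist x₀ (geodRetract x₀ x (c' / c * nndist x x₀)) =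
      ((c' : ℝ≥0) : ℝ) / (c : ℝ≥0) * dist x₀ x := by
  have h' : ((c' : ℝ≥0) : ℝ) ≤ (c : ℝ≥0) := h
  rw [dist_geodRetract, dist_comm x₀ x]
  push_cast
  apply min_eq_left
  exact mul_le_of_le_one_left dist_nonneg (div_le_one_of_le₀ h' (c : ℝ≥0).2)

variable {ω : Ultrafilter ℕ}

/-- The sequence `Ξ(xₙ, (d'ₙ / dₙ) * dist xₙ x₀)`. -/
noncomputable def connectSeq {x₀ : X} (d d' : ScalingSeq ω) (x : ConeSeq x₀ d) :
    ConeSeq x₀ d' where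
  seq n := ⟨geodRetract x₀ (x.seq n).pt (d'.val n / d.val n * nndist (x.seq n).pt x₀)⟩
  bounded := by
    obtain ⟨C, hC⟩ := x.bounded
    refine ⟨C, fun n => le_trans ?_ (hC n)⟩
    have h' : (0 : ℝ) < (d'.val n : ℝ≥0) := (d'.val n).2
    rw [Rescaled.dist_def, Rescaled.dist_def, dist_comm _ x₀, dist_geodRetract, div_le_iff₀ h']
    refine (min_le_left _ _).trans_eq ?_
    push_cast
    ring

theorem dist_connectSeq_le {x₀ : X} {d d' : ScalingSeq ω} (h : d' ≤ d) (x y : ConeSeq x₀ d) :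
    dist (connectSeq d d' x) (connectSeq d d' y) ≤ dist x y := by
  refine le_of_tendsto_of_tendsto (ObservedSeq.tendsto_dist _ _) (ObservedSeq.tendsto_dist _ _) ?_
  filter_upwards [h] with n hn
  have h' : (0 : ℝ) < (d'.val n : ℝ≥0) := (d'.val n).2
  rw [Rescaled.dist_def, Rescaled.dist_def, div_le_iff₀ h']
  refine (CAT0Space.dist_le_mul (div_nonneg (d'.val n : ℝ≥0).2 (d.val n : ℝ≥0).2)
    (dist_geodRetract_add x₀ _ _) (dist_geodRetract_add x₀ _ _)
    (dist_geodRetract_ratio x₀ _ hn) (dist_geodRetract_ratio x₀ _ hn)).trans_eq ?_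
  change ((d'.val n : ℝ≥0) : ℝ) / (d.val n : ℝ≥0) * _ = _
  ring

/-- The connecting map `Θ`, from the asymptotic cone with scaling sequence `d` to the one with
scaling sequence `d' ≤ d`: it sends the class of `(xₙ)` to the class of
`(Ξ(xₙ, (d'ₙ / dₙ) * dist xₙ x₀))`. -/
noncomputable def connectMap (x₀ : X) {d d' : ScalingSeq ω} (h : d' ≤ d) :
    AsymptoticCone x₀ d → AsymptoticCone x₀ d' :=
  SeparationQuotient.lift (fun x => Ultraproduct.mk (connectSeq d d' x)) (by
    intro x y hxy
    refine SeparationQuotient.mk_eq_mk.2 (Metric.inseparable_iff.2 (le_antisymm ?_ dist_nonneg))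
    exact (dist_connectSeq_le h x y).trans_eq (Metric.inseparable_iff.1 hxy))

end Retraction

/-! ## Inverse limits of metric spaces -/

/-- The inverse limit of a system of metric spaces `E j` with connecting maps `f`. -/
structure InverseLimit {J : Type*} [Preorder J] (E : J → Type*) [∀ j, MetricSpace (E j)]
    (f : ∀ i j, j ≤ i → E i → E j) where
  val : ∀ j, E j
  compat : ∀ i j (h : j ≤ i), val j = f i j h (val i)

/-- The inverse limit metric, a priori an extended metric: the supremum of the distances of the
coordinates. -/
noncomputable instance {J : Type*} [Preorder J] (E : J → Type*) [∀ j, MetricSpace (E j)]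
    (f : ∀ i j, j ≤ i → E i → E j) : EMetricSpace (InverseLimit E f) where
  edist x y := ⨆ j, edist (x.val j) (y.val j)
  edist_self x := by simp
  edist_comm x y := by simp only [edist_comm]
  edist_triangle x y z := iSup_le fun j => (edist_triangle _ (y.val j) _).trans
    (add_le_add (le_iSup (fun j => edist (x.val j) (y.val j)) j)
      (le_iSup (fun j => edist (y.val j) (z.val j)) j))
  eq_of_edist_eq_zero {x y} h := by
    have hv : x.val = y.val := by
      funext j
      exact edist_eq_zero.1 (ENNReal.iSup_eq_zero.1 h j)
    cases x
    cases y
    simpa using hv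

/-- The inverse limit of all asymptotic cones of `X` (for the fixed basepoint and ultrafilter). -/
abbrev ConeInverseLimit {X : Type*} [MetricSpace X] [CAT0Space X] (ω : Ultrafilter ℕ) (x₀ : X) :
    Type _ :=
  InverseLimit (fun d : ScalingSeq ω => AsymptoticCone x₀ d) (fun _ _ h => connectMap x₀ h)

/-! ## Euclidean cones -/

/-- `(s, y) ~ (t, z)` if they are equal or `s = t = 0`. -/
def coneSetoid (Y : Type*) : Setoid (ℝ≥0 × Y) where
  r p q := p = q ∨ (p.1 = 0 ∧ q.1 = 0)
  iseqv :=
    { refl := fun _ => Or.inl rfl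
      symm := by
        rintro p q (rfl | h)
        · exact Or.inl rfl
        · exact Or.inr h.symm
      trans := by
        rintro p q r (rfl | h) (rfl | h')
        · exact Or.inl rfl
        · exact Or.inr h'
        · exact Or.inr h
        · exact Or.inr ⟨h.1, h'.2⟩ }

/-- The Euclidean cone over `Y`. -/
def EuclideanCone (Y : Type*) : Type _ := Quotient (coneSetoid Y)

namespace EuclideanCone

theorem dist_planePt_mono {s t a b : ℝ} (hs : 0 ≤ s) (ht : 0 ≤ t) (ha : 0 ≤ a) (hab : a ≤ b)
    (hb : b ≤ Real.pi) :
    dist (planePt s a) (planePt t 0) ≤ dist (planePt s b) (planePt t 0) := by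
  rw [dist_planePt, dist_planePt, sub_zero, sub_zero]
  apply Real.sqrt_le_sqrt
  have := Real.cos_le_cos_of_nonneg_of_le_pi ha hb hab
  nlinarith [mul_nonneg hs ht]

theorem dist_planePt_add (s t a b : ℝ) :
    dist (planePt s (a + b)) (planePt t b) = dist (planePt s a) (planePt t 0) := by
  rw [dist_planePt, dist_planePt]
  simp

theorem dist_planePt_triangle {s u t a b : ℝ} (hu : 0 ≤ u) (ht : 0 ≤ t)
    (ha' : a ≤ Real.pi) (hb' : b ≤ Real.pi) :
    dist (planePt s (min Real.pi (a + b))) (planePt t 0) ≤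
      dist (planePt s a) (planePt u 0) + dist (planePt u b) (planePt t 0) := by
  rcases le_total Real.pi (a + b) with h | h
  · rw [min_eq_left h]
    have h1 := dist_planePt_mono hu ht (a := Real.pi - a) (b := b) (by linarith) (by linarith) hb'
    refine le_trans ?_ (add_le_add le_rfl h1)
    rw [← dist_planePt_add s u a (Real.pi - a)]
    simpa using dist_triangle (planePt s Real.pi) (planePt u (Real.pi - a)) (planePt t 0)
  · rw [min_eq_right h, ← dist_planePt_add s u a b]
    exact dist_triangle _ _ _

variable {Y : Type*} [MetricSpace Y]

/-- `√(s² + t² - 2 s t cos (min {π, d(y, z)}))`. -/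
noncomputable def preDist (p q : ℝ≥0 × Y) : ℝ :=
  √((p.1 : ℝ) ^ 2 + (q.1 : ℝ) ^ 2
    - 2 * (p.1 : ℝ) * (q.1 : ℝ) * Real.cos (min Real.pi (dist p.2 q.2)))

theorem preDist_eq (p q : ℝ≥0 × Y) :
    preDist p q = dist (planePt p.1 (min Real.pi (dist p.2 q.2))) (planePt q.1 0) := by
  rw [dist_planePt, sub_zero, preDist]

theorem preDist_comm (p q : ℝ≥0 × Y) : preDist p q = preDist q p := by
  unfold preDist
  rw [dist_comm p.2 q.2]
  congr 1
  ring

theorem preDist_triangle (p q r : ℝ≥0 × Y) : preDist p r ≤ preDist p q + preDist q r := by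
  have hm : ∀ y z : Y, 0 ≤ min Real.pi (dist y z) := fun y z => le_min Real.pi_pos.le dist_nonneg
  simp only [preDist_eq]
  refine le_trans ?_ (dist_planePt_triangle q.1.2 r.1.2 (min_le_left _ _) (min_le_left _ _))
  refine dist_planePt_mono p.1.2 r.1.2 (hm _ _) (le_min (min_le_left _ _) ?_) (min_le_left _ _)
  have h := dist_triangle p.2 q.2 r.2
  have := Real.pi_pos
  rcases le_total Real.pi (dist p.2 q.2) with h1 | h1
  · rw [min_eq_left h1]
    exact (min_le_left _ _).trans (le_add_of_nonneg_right (hm _ _))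
  rcases le_total Real.pi (dist q.2 r.2) with h2 | h2
  · rw [min_eq_left h2]
    exact (min_le_left _ _).trans (le_add_of_nonneg_left (hm _ _))
  rw [min_eq_right h1, min_eq_right h2]
  exact (min_le_right _ _).trans h

theorem preDist_self (p : ℝ≥0 × Y) : preDist p p = 0 := by
  rw [preDist_eq, dist_self, min_eq_right Real.pi_pos.le, dist_self]

theorem preDist_eq_zero_iff (p q : ℝ≥0 × Y) : preDist p q = 0 ↔ coneSetoid Y p q := by
  constructor
  · intro h
    have h1 : dist (planePt p.1 0) (planePt q.1 0) ≤ preDist p q := by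
      rw [preDist_eq]
      exact dist_planePt_mono p.1.2 q.1.2 le_rfl (le_min Real.pi_pos.le dist_nonneg)
        (min_le_left _ _)
    rw [h, dist_planePt_same] at h1
    have h2 : (p.1 : ℝ) = q.1 := sub_eq_zero.1 (abs_eq_zero.1 (le_antisymm h1 (abs_nonneg _)))
    have h2' : p.1 = q.1 := NNReal.coe_injective h2
    rcases eq_or_ne p.1 0 with h0 | h0
    · exact Or.inr ⟨h0, h2' ▸ h0⟩
    left
    have h0' : (0 : ℝ) < q.1 := by
      rw [← h2]
      exact_mod_cast pos_iff_ne_zero.2 h0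
    refine Prod.ext h2' ?_
    rw [preDist, h2, Real.sqrt_eq_zero'] at h
    have hc : Real.cos (min Real.pi (dist p.2 q.2)) = 1 := by
      refine le_antisymm (Real.cos_le_one _) ?_
      have : 0 < (q.1 : ℝ) ^ 2 := by positivity
      nlinarith
    have hlt : -(2 * Real.pi) < min Real.pi (dist p.2 q.2) :=
      lt_of_lt_of_le (by linarith [Real.pi_pos]) (le_min Real.pi_pos.le dist_nonneg)
    have hz := (Real.cos_eq_one_iff_of_lt_of_lt hlt
      (lt_of_le_of_lt (min_le_left _ _) (by linarith [Real.pi_pos]))).1 hc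
    rcases min_choice Real.pi (dist p.2 q.2) with h3 | h3
    · exact absurd (h3.symm.trans hz) Real.pi_pos.ne'
    · exact dist_eq_zero.1 (h3.symm.trans hz)
  · rintro (rfl | ⟨h1, h2⟩)
    · exact preDist_self p
    · simp [preDist, h1, h2]

theorem preDist_congr {p p' q q' : ℝ≥0 × Y} (hp : coneSetoid Y p p') (hq : coneSetoid Y q q') :
    preDist p q = preDist p' q' := by
  rw [← preDist_eq_zero_iff] at hp hq
  have h1 := preDist_triangle p p' q
  have h2 := preDist_triangle p' q' q
  have h3 := preDist_triangle p' p q'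
  have h4 := preDist_triangle p q q'
  rw [preDist_comm q' q] at h2
  rw [preDist_comm p' p] at h3
  linarith

noncomputable instance : MetricSpace (EuclideanCone Y) where
  dist := Quotient.lift₂ preDist fun _ _ _ _ h₁ h₂ => preDist_congr h₁ h₂
  dist_self := by
    rintro ⟨p⟩
    exact preDist_self p
  dist_comm := by
    rintro ⟨p⟩ ⟨q⟩
    exact preDist_comm p q
  dist_triangle := by
    rintro ⟨p⟩ ⟨q⟩ ⟨r⟩
    exact preDist_triangle p q r
  eq_of_dist_eq_zero := by
    rintro ⟨p⟩ ⟨q⟩ h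
    exact Quotient.sound ((preDist_eq_zero_iff p q).1 h)

end EuclideanCone

/-! ## The maps `Ψ` -/

section Psi

variable {X : Type*} [MetricSpace X] [CAT0Space X] {x₀ : X} {ω : Ultrafilter ℕ}

/-- The ultraproduct of the angle boundary. (The angle metric is bounded, so every sequence of rays
is an observed sequence, whatever `e` is.) -/
abbrev AngleUltraproduct (ω : Ultrafilter ℕ) (e : ℕ → BoundaryRay x₀) : Type _ :=
  Ultraproduct (E := fun _ => BoundaryRay x₀) ω e

/-- The sequence `αₙ(t dₙ)`. -/
def raySeq {e : ℕ → BoundaryRay x₀} (d : ScalingSeq ω) (t : ℝ≥0)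
    (α : ObservedSeq (E := fun _ => BoundaryRay x₀) ω e) : ConeSeq x₀ d where
  seq n := ⟨α.seq n (t * d.val n)⟩
  bounded := by
    refine ⟨t, fun n => ?_⟩
    have h' : (0 : ℝ) < (d.val n : ℝ≥0) := (d.val n).2
    rw [Rescaled.dist_def, dist_comm, BoundaryRay.dist_base, div_le_iff₀ h']
    simp

theorem dist_raySeq_le {e : ℕ → BoundaryRay x₀} (d : ScalingSeq ω) (t : ℝ≥0)
    (α β : ObservedSeq (E := fun _ => BoundaryRay x₀) ω e) :
    dist (raySeq d t α) (raySeq d t β) ≤ t * dist α β := by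
  refine le_of_tendsto_of_tendsto' (ObservedSeq.tendsto_dist _ _)
    ((ObservedSeq.tendsto_dist α β).const_mul (t : ℝ)) fun n => ?_
  have h' : (0 : ℝ) < (d.val n : ℝ≥0) := (d.val n).2
  rw [Rescaled.dist_def, div_le_iff₀ h']
  refine (BoundaryRay.dist_le_mul_angle (α.seq n) (β.seq n) _).trans_eq ?_
  change _ = t * BoundaryRay.angle (α.seq n) (β.seq n) * ((d.val n : ℝ≥0) : ℝ)
  push_cast
  ring

/-- The map `Ψ` from the Euclidean cone over the ultraproduct of the angle boundary to the
asymptotic cone with scaling sequence `d`: it sends the class of `(t, (αₙ))` to the class of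
`(αₙ(t dₙ))`. -/
noncomputable def conePsi {e : ℕ → BoundaryRay x₀} (d : ScalingSeq ω) :
    EuclideanCone (AngleUltraproduct ω e) → AsymptoticCone x₀ d :=
  Quotient.lift
    (fun p : ℝ≥0 × AngleUltraproduct ω e =>
      SeparationQuotient.lift (fun α => Ultraproduct.mk (raySeq d p.1 α)) (by
        intro α β h
        refine SeparationQuotient.mk_eq_mk.2
          (Metric.inseparable_iff.2 (le_antisymm ?_ dist_nonneg))
        refine (dist_raySeq_le d p.1 α β).trans_eq ?_
        rw [Metric.inseparable_iff.1 h, mul_zero]) p.2)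
    (by
      rintro ⟨s, x⟩ ⟨t, y⟩ (h | ⟨hs, ht⟩)
      · rw [h]
      · change s = 0 at hs
        change t = 0 at ht
        subst hs ht
        obtain ⟨α, rfl⟩ := SeparationQuotient.surjective_mk x
        obtain ⟨β, rfl⟩ := SeparationQuotient.surjective_mk y
        change Ultraproduct.mk (raySeq d 0 α) = Ultraproduct.mk (raySeq d 0 β)
        congr 1
        unfold raySeq
        congr 1
        funext n
        congr 1
        rw [zero_mul, (α.seq n).map_zero, (β.seq n).map_zero])

end Psi

/-! Finiteness. The connecting map from `d` to `d'` multiplies the distance of the `n`-th coordinate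
to `x₀` by `d'ₙ / dₙ`, which is exactly undone by the change of metric. So a compatible family has
the same distance to the basepoint in any two comparable cones, hence in all cones, because scaling
sequences are directed. The triangle inequality through the basepoint then bounds every coordinate
distance by one constant (`dist_coneBase_val`).

Completeness. Each cone is complete by a diagonal argument that uses non-principality of `ω`, and
the connecting maps are 1-Lipschitz by CAT(0) comparison. A Cauchy sequence for the supremum metric
therefore converges in each coordinate, uniformly in the coordinate, and continuity makes the limit
family compatible.

Embedding. Geodesics are unique, so the connecting maps slide points along rays and the maps `Ψ`
commute with them. By the law of cosines, `dist (α (s c)) (β (t c)) / c` is the third side of a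
Euclidean triangle with fixed sides `s`, `t`, whose angle is a comparison angle that grows with `c`
towards `∠(α, β)`. Hence no `Ψ` increases distances. A single `Ψ` may shrink them, since for a
sequence of pairs `(αₙ, βₙ)` the angles can converge arbitrarily slowly; but for two given points
some `d` grows fast enough to recover the full distance, so the supremum over `d` is the cone
distance. -/

/-! ## Completeness of ultraproducts -/

namespace ObservedSeq

variable {E : ℕ → Type*} [∀ n, MetricSpace (E n)] {ω : Ultrafilter ℕ} {e : ∀ n, E n}

/-- Ultraproducts along a non-principal ultrafilter are complete, by a diagonal argument. -/
theorem completeSpace (hω : (ω : Filter ℕ) ≤ Filter.cofinite) :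
    CompleteSpace (ObservedSeq ω e) := by
  classical
  refine Metric.complete_of_convergent_controlled_sequences (fun k => (1 / 2 : ℝ) ^ k)
    (fun k => by positivity) fun u hu => ?_
  -- The estimates on the `u j` hold only in the ultralimit, so at a given `n` only an initial run
  -- of them may be valid. The diagonal sequence follows this run as far as it goes; the cap at `n`
  -- ensures that a longest run exists.
  let P : ℕ → ℕ → Prop := fun n k =>
    ∀ j < k, dist ((u j).seq n) ((u (j + 1)).seq n) ≤ (1 / 2 : ℝ) ^ j
  let k : ℕ → ℕ := fun n => Nat.findGreatest (P n) n
  have hk : ∀ n, P n (k n) := fun n =>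
    Nat.findGreatest_spec (P := P n) (Nat.zero_le n) fun j hj => absurd hj (Nat.not_lt_zero j)
  -- A telescoping geometric sum; keeping the negative tail term lets the induction close.
  have hsum : ∀ n j m, j ≤ m → P n m →
      dist ((u j).seq n) ((u m).seq n) ≤ 2 * (1 / 2 : ℝ) ^ j - 2 * (1 / 2 : ℝ) ^ m := by
    intro n j m hjm
    induction m, hjm using Nat.le_induction with
    | base => intro _; simp
    | succ m _ ih =>
      intro hP
      have h1 := ih fun i hi => hP i (hi.trans (Nat.lt_succ_self m))
      have h2 := hP m (Nat.lt_succ_self m)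
      have h3 := dist_triangle ((u j).seq n) ((u m).seq n) ((u (m + 1)).seq n)
      rw [pow_succ]
      linarith
  have hclose : ∀ n j, j ≤ k n → dist ((u j).seq n) ((u (k n)).seq n) ≤ 2 * (1 / 2 : ℝ) ^ j := by
    intro n j hj
    have h1 := hsum n j (k n) hj (hk n)
    have h2 : (0 : ℝ) < (1 / 2) ^ k n := by positivity
    linarith
  -- The diagonal index tends to infinity along `ω`: `n ≥ j` holds almost surely by
  -- non-principality, and `P n j` consists of finitely many conditions, each almost sure because
  -- the limit distance lies strictly below its bound.
  have hmem : ∀ j, ∀ᶠ n in (ω : Filter ℕ), j ≤ k n := by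
    intro j
    have h1 : ∀ᶠ n in (ω : Filter ℕ), j ≤ n := by
      refine hω ?_
      rw [Nat.cofinite_eq_atTop]
      exact eventually_ge_atTop j
    have h2 : ∀ᶠ n in (ω : Filter ℕ), P n j := by
      refine (Filter.eventually_all_finite (Set.finite_lt_nat j)).2 fun i _ => ?_
      exact ((tendsto_dist (u i) (u (i + 1))).eventually_lt_const
        (hu i i (i + 1) le_rfl (Nat.le_succ i))).mono fun n hn => hn.le
    filter_upwards [h1, h2] with n hn hP using Nat.le_findGreatest hn hP
  obtain ⟨C, hC⟩ := (u 0).bounded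
  let z : ObservedSeq ω e :=
    { seq := fun n => (u (k n)).seq n
      -- An observed sequence needs a bound at every `n`, not just almost every one. This is
      -- available because `P n (k n)` holds at every `n`.
      bounded := by
        refine ⟨2 + C, fun n => (dist_triangle_left _ _ ((u 0).seq n)).trans
          (add_le_add ?_ (hC n))⟩
        simpa using hclose n 0 (Nat.zero_le _) }
  refine ⟨z, tendsto_iff_dist_tendsto_zero.2 ?_⟩
  have hz : ∀ j, dist (u j) z ≤ 2 * (1 / 2 : ℝ) ^ j := fun j =>
    le_of_tendsto (tendsto_dist (u j) z) ((hmem j).mono fun n hn => hclose n j hn)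
  refine squeeze_zero (fun _ => dist_nonneg) hz ?_
  simpa using (tendsto_pow_atTop_nhds_zero_of_lt_one (r := (1 / 2 : ℝ)) (by norm_num)
    (by norm_num)).const_mul 2

end ObservedSeq

theorem Ultraproduct.dist_mk {E : ℕ → Type*} [∀ n, MetricSpace (E n)] {ω : Ultrafilter ℕ}
    {e : ∀ n, E n} (x y : ObservedSeq ω e) :
    dist (Ultraproduct.mk x) (Ultraproduct.mk y) = dist x y :=
  SeparationQuotient.dist_mk x y

/-! ## Completeness of inverse limits -/

namespace InverseLimit

variable {J : Type*} [Preorder J] {E : J → Type*} [∀ j, MetricSpace (E j)]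
  {f : ∀ i j, j ≤ i → E i → E j}

theorem edist_val_le (x y : InverseLimit E f) (j : J) : edist (x.val j) (y.val j) ≤ edist x y :=
  le_iSup (fun j => edist (x.val j) (y.val j)) j

/-- Coordinatewise limits form a compatible family because the connecting maps are continuous. The
Cauchy condition for the supremum bounds all coordinates by the same `N`, so the convergence is
uniform. -/
theorem completeSpace [∀ j, CompleteSpace (E j)] (hf : ∀ i j h, Continuous (f i j h)) :
    CompleteSpace (InverseLimit E f) := by
  refine UniformSpace.complete_of_cauchySeq_tendsto fun u hu => ?_
  have hval : ∀ j, UniformContinuous fun x : InverseLimit E f => x.val j := fun j =>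
    (LipschitzWith.of_edist_le fun x y => edist_val_le x y j).uniformContinuous
  have hlim : ∀ j, ∃ l, Tendsto (fun n => (u n).val j) atTop (𝓝 l) := fun j =>
    cauchySeq_tendsto_of_complete ((hval j).comp_cauchySeq hu)
  choose l hl using hlim
  refine ⟨⟨l, fun i j h => tendsto_nhds_unique (hl j) ?_⟩, ?_⟩
  · exact (((hf i j h).tendsto (l i)).comp (hl i)).congr fun n => ((u n).compat i j h).symm
  rw [EMetric.tendsto_atTop]
  intro ε hε
  -- Strict bounds become weak ones under limits and suprema; the room between `δ` and `ε` restores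
  -- strictness.
  obtain ⟨δ, hδ, hδε⟩ := exists_between hε
  obtain ⟨N, hN⟩ := EMetric.cauchySeq_iff.1 hu δ hδ
  refine ⟨N, fun n hn => lt_of_le_of_lt (iSup_le fun j => ?_) hδε⟩
  refine le_of_tendsto (tendsto_const_nhds.edist (hl j)) ?_
  filter_upwards [eventually_ge_atTop N] with m hm
  exact (edist_val_le (u n) (u m) j).trans (hN n hn m hm).le

end InverseLimit

/-! ## The inverse limit of the asymptotic cones -/

namespace ScalingSeq

variable {ω : Ultrafilter ℕ}

/-- Lets coordinates at incomparable scaling sequences be compared through a common larger one. -/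
theorem directed (d d' : ScalingSeq ω) : ∃ c : ScalingSeq ω, d ≤ c ∧ d' ≤ c :=
  ⟨⟨fun n => max (d.val n) (d'.val n), tendsto_atTop_mono
      (fun _ => NNReal.coe_le_coe.2 (Subtype.coe_le_coe.2 (le_max_left _ _))) d.diverges⟩,
    Eventually.of_forall fun _ => le_max_left _ _, Eventually.of_forall fun _ => le_max_right _ _⟩

end ScalingSeq

section Cones

variable {X : Type*} [MetricSpace X] {ω : Ultrafilter ℕ}

/-- The basepoint of the asymptotic cone. -/
def coneBaseSeq (x₀ : X) (d : ScalingSeq ω) : ConeSeq x₀ d where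
  seq _ := ⟨x₀⟩
  bounded := ⟨0, fun _ => (dist_self _).le⟩

/-- The class of the basepoint of the asymptotic cone. -/
noncomputable def coneBase (x₀ : X) (d : ScalingSeq ω) : AsymptoticCone x₀ d :=
  Ultraproduct.mk (coneBaseSeq x₀ d)

variable [CAT0Space X]

theorem connectMap_mk {x₀ : X} {d d' : ScalingSeq ω} (h : d' ≤ d) (x : ConeSeq x₀ d) :
    connectMap x₀ h (Ultraproduct.mk x) = Ultraproduct.mk (connectSeq d d' x) := rfl

theorem continuous_connectMap {x₀ : X} {d d' : ScalingSeq ω} (h : d' ≤ d) :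
    Continuous (connectMap x₀ h) := by
  refine (LipschitzWith.of_dist_le_mul (K := 1) fun x y => ?_).continuous
  obtain ⟨x, rfl⟩ := SeparationQuotient.surjective_mk x
  obtain ⟨y, rfl⟩ := SeparationQuotient.surjective_mk y
  rw [NNReal.coe_one, one_mul]
  exact dist_connectSeq_le h x y

/-- The retraction shrinks the radius by the factor `d'ₙ / dₙ`, and dividing by `d'ₙ` instead of
`dₙ` cancels it. -/
theorem dist_coneBase_connectMap {x₀ : X} {d d' : ScalingSeq ω} (h : d' ≤ d)
    (x : AsymptoticCone x₀ d) :
    dist (coneBase x₀ d') (connectMap x₀ h x) = dist (coneBase x₀ d) x := by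
  obtain ⟨x, rfl⟩ := SeparationQuotient.surjective_mk x
  refine tendsto_nhds_unique (ObservedSeq.tendsto_dist (coneBaseSeq x₀ d') (connectSeq d d' x))
    ((ObservedSeq.tendsto_dist (coneBaseSeq x₀ d) x).congr' ?_)
  filter_upwards [h] with n hn
  have h' : ((d'.val n : ℝ≥0) : ℝ) ≠ 0 := by exact_mod_cast (d'.val n).2.ne'
  have hd : ((d.val n : ℝ≥0) : ℝ) ≠ 0 := by exact_mod_cast (d.val n).2.ne'
  rw [Rescaled.dist_def, Rescaled.dist_def]
  change dist x₀ _ / _ = dist x₀ (geodRetract x₀ _ _) / _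
  rw [dist_geodRetract_ratio x₀ _ hn]
  field_simp

theorem dist_coneBase_val {x₀ : X} (x : ConeInverseLimit ω x₀) (d d' : ScalingSeq ω) :
    dist (coneBase x₀ d) (x.val d) = dist (coneBase x₀ d') (x.val d') := by
  obtain ⟨c, hc, hc'⟩ := ScalingSeq.directed d d'
  rw [x.compat c d hc, x.compat c d' hc', dist_coneBase_connectMap, dist_coneBase_connectMap]

theorem ConeInverseLimit.edist_ne_top {x₀ : X} (x y : ConeInverseLimit ω x₀) : edist x y ≠ ⊤ := by
  -- A principal `ω` is allowed here and admits no scaling sequence; the supremum is then empty,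
  -- hence zero.
  rcases isEmpty_or_nonempty (ScalingSeq ω) with hJ | ⟨⟨d₀⟩⟩
  · exact ne_top_of_le_ne_top ENNReal.zero_ne_top (iSup_le fun d => (hJ.false d).elim)
  refine ne_top_of_le_ne_top (ENNReal.ofReal_ne_top
    (r := dist (coneBase x₀ d₀) (x.val d₀) + dist (coneBase x₀ d₀) (y.val d₀)))
    (iSup_le fun d => ?_)
  rw [edist_dist, dist_coneBase_val x d₀ d, dist_coneBase_val y d₀ d]
  exact ENNReal.ofReal_le_ofReal (dist_triangle_left _ _ _)

theorem ConeInverseLimit.completeSpace (hω : (ω : Filter ℕ) ≤ Filter.cofinite) (x₀ : X) :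
    CompleteSpace (ConeInverseLimit ω x₀) := by
  have (d : ScalingSeq ω) : CompleteSpace (AsymptoticCone x₀ d) :=
    have := ObservedSeq.completeSpace (E := fun n => Rescaled X (d.val n)) (e := fun _ => ⟨x₀⟩) hω
    inferInstance
  exact InverseLimit.completeSpace fun _ _ h => continuous_connectMap h

/-- Points at the same distance from `o` on geodesics from `o` to `x` are equal. -/
theorem CAT0Space.eq_of_dist_eq {o x p q : X} (hp : dist o p + dist p x = dist o x)
    (hq : dist o q + dist q x = dist o x) (hpq : dist o p = dist o q) : p = q := by
  rcases (dist_nonneg (x := o) (y := x)).eq_or_lt with h | h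
  · have h1 : dist o p = 0 := by
      linarith [dist_nonneg (x := o) (y := p), dist_nonneg (x := p) (y := x)]
    exact (dist_eq_zero.1 h1).symm.trans (dist_eq_zero.1 (hpq ▸ h1))
  -- Comparison for the degenerate triangle whose two sides from `o` both end at `x`.
  · have := CAT0Space.dist_le_mul (c := dist o p / dist o x) (by positivity) hp hq
      (by field_simp) (by rw [← hpq]; field_simp)
    rw [dist_self, mul_zero] at this
    exact dist_le_zero.1 this

end Cones

/-! ## Distances between points of rays -/

namespace BoundaryRay

variable {X : Type*} [MetricSpace X] {x₀ : X}

theorem dist_sq_apply (α β : BoundaryRay x₀) (s t : ℝ≥0) :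
    dist (α s) (β t) ^ 2 = (s : ℝ) ^ 2 + (t : ℝ) ^ 2
      - 2 * s * t * Real.cos (compAngle x₀ (α s) (β t)) := by
  -- At radius zero the comparison angle has a meaningless default value, but its cosine is
  -- multiplied by `s * t = 0`.
  rcases eq_or_ne s 0 with rfl | hs
  · simp [α.map_zero, dist_base]
  rcases eq_or_ne t 0 with rfl | ht
  · simp [β.map_zero, dist_comm _ x₀, dist_base]
  have h := dist_sq_eq_compAngle (p := x₀) (x := α s) (y := β t)
    (by rw [dist_base]; exact_mod_cast pos_iff_ne_zero.2 hs)
    (by rw [dist_base]; exact_mod_cast pos_iff_ne_zero.2 ht)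
  rwa [dist_base, dist_base] at h

/-- Isolates the dependence on `c` in the comparison angle, so that bounds and limits of rescaled
distances reduce to those of angles. -/
theorem dist_apply_mul_div (α β : BoundaryRay x₀) (s t : ℝ≥0) {c : ℝ≥0} (hc : 0 < c) :
    dist (α (s * c)) (β (t * c)) / c = √((s : ℝ) ^ 2 + (t : ℝ) ^ 2
      - 2 * s * t * Real.cos (compAngle x₀ (α (s * c)) (β (t * c)))) := by
  have hc' : (c : ℝ) ≠ 0 := by exact_mod_cast hc.ne'
  rw [← Real.sqrt_sq (div_nonneg dist_nonneg c.coe_nonneg), div_pow, dist_sq_apply]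
  congr 1
  push_cast
  field_simp

variable [CAT0Space X]

theorem preDist_eq_sqrt (α β : BoundaryRay x₀) (s t : ℝ≥0) :
    EuclideanCone.preDist (s, α) (t, β) =
      √((s : ℝ) ^ 2 + (t : ℝ) ^ 2 - 2 * s * t * Real.cos (angle α β)) := by
  have : min Real.pi (dist α β) = angle α β := min_eq_right (angle_le_pi α β)
  rw [EuclideanCone.preDist, this]

theorem dist_apply_mul_div_le (α β : BoundaryRay x₀) (s t : ℝ≥0) {c : ℝ≥0} (hc : 0 < c) :
    dist (α (s * c)) (β (t * c)) / c ≤ EuclideanCone.preDist (s, α) (t, β) := by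
  rw [dist_apply_mul_div α β s t hc, preDist_eq_sqrt]
  apply Real.sqrt_le_sqrt
  rcases eq_or_ne s 0 with rfl | hs
  · simp
  rcases eq_or_ne t 0 with rfl | ht
  · simp
  have := Real.cos_le_cos_of_nonneg_of_le_pi (compAngle_nonneg _ _ _) (angle_le_pi α β)
    (compAngle_le_angle α β (mul_pos (pos_iff_ne_zero.2 hs) hc) (mul_pos (pos_iff_ne_zero.2 ht) hc))
  have hst : 0 ≤ 2 * (s : ℝ) * t := by positivity
  linarith [mul_le_mul_of_nonneg_left this hst]

/-- The angle is defined with equal times on both rays. Monotonicity squeezes the comparison angle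
at unequal times between the one at the common time `min s t * c` and the limit angle. -/
theorem tendsto_compAngle_mul (α β : BoundaryRay x₀) {s t : ℝ≥0} (hs : 0 < s) (ht : 0 < t) :
    Tendsto (fun c : ℝ≥0 => compAngle x₀ (α (s * c)) (β (t * c))) atTop (𝓝 (angle α β)) := by
  have hm : 0 < min s t := lt_min hs ht
  refine tendsto_of_tendsto_of_tendsto_of_le_of_le'
    ((tendsto_angle α β).comp (tendsto_id.const_mul_atTop hm)) tendsto_const_nhds ?_ ?_
  · filter_upwards [eventually_gt_atTop (0 : ℝ≥0)] with c hc
    exact compAngle_mono α β (mul_pos hm hc) (mul_pos hm hc)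
      (mul_le_mul_left (min_le_left _ _) _) (mul_le_mul_left (min_le_right _ _) _)
  · filter_upwards [eventually_gt_atTop (0 : ℝ≥0)] with c hc
    exact compAngle_le_angle α β (mul_pos hs hc) (mul_pos ht hc)

theorem tendsto_dist_apply_mul_div (α β : BoundaryRay x₀) (s t : ℝ≥0) :
    Tendsto (fun c : ℝ≥0 => dist (α (s * c)) (β (t * c)) / c) atTop
      (𝓝 (EuclideanCone.preDist (s, α) (t, β))) := by
  rw [preDist_eq_sqrt]
  -- The product is treated as a whole because for `s = 0` or `t = 0` the comparison angle need not
  -- tend to `angle α β`.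
  have key : Tendsto (fun c : ℝ≥0 => 2 * (s : ℝ) * t *
      Real.cos (compAngle x₀ (α (s * c)) (β (t * c)))) atTop
      (𝓝 (2 * s * t * Real.cos (angle α β))) := by
    rcases eq_or_ne s 0 with rfl | hs
    · simp
    rcases eq_or_ne t 0 with rfl | ht
    · simp
    exact ((Real.continuous_cos.tendsto _).comp
      (tendsto_compAngle_mul α β (pos_iff_ne_zero.2 hs) (pos_iff_ne_zero.2 ht))).const_mul _
  refine ((tendsto_const_nhds.sub key).sqrt).congr' ?_
  filter_upwards [eventually_gt_atTop (0 : ℝ≥0)] with c hc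
  exact (dist_apply_mul_div α β s t hc).symm

/-- The retraction picks its point by choice; uniqueness of geodesics forces that point to lie on
the ray. -/
theorem geodRetract_apply (α : BoundaryRay x₀) {t r : ℝ≥0} (h : r ≤ t) :
    geodRetract x₀ (α t) r = α r := by
  refine CAT0Space.eq_of_dist_eq (dist_geodRetract_add x₀ (α t) r) (α.dist_add h) ?_
  rw [dist_geodRetract, dist_base, dist_base, min_eq_left (NNReal.coe_le_coe.2 h)]

end BoundaryRay

/-! ## The embedding of the Euclidean cone -/

section PsiEmbedding

variable {X : Type*} [MetricSpace X] [CAT0Space X] {x₀ : X} {ω : Ultrafilter ℕ}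
  {e : ℕ → BoundaryRay x₀}

/-- For fixed radii the cone distance is a continuous function of the distance in the base, so it
commutes with ultralimits. -/
theorem tendsto_preDist (s t : ℝ≥0) (α β : ObservedSeq (E := fun _ => BoundaryRay x₀) ω e) :
    Tendsto (fun n => EuclideanCone.preDist (s, α.seq n) (t, β.seq n)) ω
      (𝓝 (EuclideanCone.preDist (s, Ultraproduct.mk α) (t, Ultraproduct.mk β))) := by
  have h : Tendsto (fun n => dist (α.seq n) (β.seq n)) ω
      (𝓝 (dist (Ultraproduct.mk α) (Ultraproduct.mk β))) := ObservedSeq.tendsto_dist α β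
  exact (tendsto_const_nhds.sub (((Real.continuous_cos.tendsto _).comp
    (tendsto_const_nhds.min h)).const_mul _)).sqrt

theorem tendsto_dist_raySeq (d : ScalingSeq ω) (s t : ℝ≥0)
    (α β : ObservedSeq (E := fun _ => BoundaryRay x₀) ω e) :
    Tendsto (fun n => dist (α.seq n (s * d.val n)) (β.seq n (t * d.val n)) / (d.val n : ℝ≥0)) ω
      (𝓝 (dist (raySeq d s α) (raySeq d t β))) :=
  ObservedSeq.tendsto_dist (raySeq d s α) (raySeq d t β)

theorem dist_raySeq_le_preDist (d : ScalingSeq ω) (s t : ℝ≥0)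
    (α β : ObservedSeq (E := fun _ => BoundaryRay x₀) ω e) :
    dist (raySeq d s α) (raySeq d t β) ≤
      EuclideanCone.preDist (s, Ultraproduct.mk α) (t, Ultraproduct.mk β) :=
  le_of_tendsto_of_tendsto' (tendsto_dist_raySeq d s t α β) (tendsto_preDist s t α β) fun n =>
    BoundaryRay.dist_apply_mul_div_le _ _ s t (d.val n).2

/-- A sufficiently fast scaling sequence realizes the distance in the Euclidean cone. -/
theorem exists_preDist_le_dist_raySeq (hω : (ω : Filter ℕ) ≤ Filter.cofinite) (s t : ℝ≥0)
    (α β : ObservedSeq (E := fun _ => BoundaryRay x₀) ω e) :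
    ∃ d : ScalingSeq ω, EuclideanCone.preDist (s, Ultraproduct.mk α) (t, Ultraproduct.mk β) ≤
      dist (raySeq d s α) (raySeq d t β) := by
  have hω' : (ω : Filter ℕ) ≤ atTop := hω.trans_eq Nat.cofinite_eq_atTop
  -- Each scale is chosen separately for the pair of rays at index `n`: at least `n`, so that the
  -- scales diverge, and large enough to leave an error `1 / (n + 1)`, which vanishes along `ω`.
  have hex : ∀ n : ℕ, ∃ c : {c : ℝ≥0 // 0 < c}, (n : ℝ≥0) ≤ c ∧
      EuclideanCone.preDist (s, α.seq n) (t, β.seq n) - 1 / ((n : ℝ) + 1) ≤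
        dist (α.seq n (s * c)) (β.seq n (t * c)) / (c : ℝ≥0) := by
    intro n
    have hn : (0 : ℝ) < 1 / ((n : ℝ) + 1) := by positivity
    obtain ⟨c, h1, h2, h3⟩ := (((BoundaryRay.tendsto_dist_apply_mul_div (α.seq n) (β.seq n)
      s t).eventually_const_lt (sub_lt_self _ hn)).and
      ((eventually_ge_atTop (n : ℝ≥0)).and (eventually_gt_atTop 0))).exists
    exact ⟨⟨c, h3⟩, h2, h1.le⟩
  choose c hc hcd using hex
  let d : ScalingSeq ω :=
    ⟨c, tendsto_atTop_mono (fun n => (NNReal.coe_natCast n).symm.le.trans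
      (NNReal.coe_le_coe.2 (hc n))) (tendsto_natCast_atTop_atTop.mono_left hω')⟩
  refine ⟨d, le_of_tendsto_of_tendsto' ?_ (tendsto_dist_raySeq d s t α β) hcd⟩
  simpa using (tendsto_preDist s t α β).sub (tendsto_one_div_add_atTop_nhds_zero_nat.mono_left hω')

/-- The point of the ray at time `t * dₙ` lies at that distance from `x₀`, so the prescribed radius
is `t * d'ₙ` and the retraction moves back along the ray to that time. -/
theorem connectMap_raySeq {d d' : ScalingSeq ω} (h : d' ≤ d) (t : ℝ≥0)
    (α : ObservedSeq (E := fun _ => BoundaryRay x₀) ω e) :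
    connectMap x₀ h (Ultraproduct.mk (raySeq d t α)) = Ultraproduct.mk (raySeq d' t α) := by
  rw [connectMap_mk, ← dist_eq_zero, Ultraproduct.dist_mk]
  refine tendsto_nhds_unique (ObservedSeq.tendsto_dist _ _) (tendsto_const_nhds.congr' ?_)
  filter_upwards [h] with n hn
  have hd : (d.val n : ℝ≥0) ≠ 0 := (d.val n).2.ne'
  have hr : (d'.val n : ℝ≥0) / d.val n * nndist (α.seq n (t * d.val n)) x₀ = t * d'.val n := by
    have : nndist (α.seq n (t * d.val n)) x₀ = t * d.val n := by
      ext
      rw [coe_nndist, dist_comm, BoundaryRay.dist_base]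
    rw [this]
    field_simp
  have hle : t * (d'.val n : ℝ≥0) ≤ t * d.val n := mul_le_mul_right (Subtype.coe_le_coe.2 hn) t
  have heq : (connectSeq d d' (raySeq d t α)).seq n = (raySeq d' t α).seq n := by
    change Rescaled.mk (geodRetract x₀ (α.seq n (t * d.val n))
      ((d'.val n : ℝ≥0) / d.val n * nndist (α.seq n (t * d.val n)) x₀)) =
      Rescaled.mk (α.seq n (t * d'.val n))
    rw [hr, BoundaryRay.geodRetract_apply _ hle]
  rw [heq, dist_self]

theorem EuclideanCone.exists_rep (u : EuclideanCone (AngleUltraproduct ω e)) :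
    ∃ (t : ℝ≥0) (α : ObservedSeq (E := fun _ => BoundaryRay x₀) ω e),
      u = Quotient.mk _ (t, Ultraproduct.mk α) := by
  obtain ⟨⟨t, x⟩, rfl⟩ := Quotient.exists_rep u
  obtain ⟨α, rfl⟩ := SeparationQuotient.surjective_mk x
  exact ⟨t, α, rfl⟩

/-- The family of the maps `Ψ`, with values in the inverse limit. -/
noncomputable def conePsiLimit (u : EuclideanCone (AngleUltraproduct ω e)) :
    ConeInverseLimit ω x₀ where
  val d := conePsi d u
  compat d d' h := by
    obtain ⟨t, α, rfl⟩ := EuclideanCone.exists_rep u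
    exact (connectMap_raySeq h t α).symm

/-- Every coordinate distance is at most the cone distance, and a scaling sequence adapted to the
two points attains it. -/
theorem isometry_conePsiLimit (hω : (ω : Filter ℕ) ≤ Filter.cofinite) :
    Isometry (conePsiLimit (ω := ω) (e := e)) := by
  intro u v
  obtain ⟨s, α, hu⟩ := EuclideanCone.exists_rep u
  obtain ⟨t, β, hv⟩ := EuclideanCone.exists_rep v
  have huv : dist u v = EuclideanCone.preDist (s, Ultraproduct.mk α) (t, Ultraproduct.mk β) := by
    rw [hu, hv]
    rfl
  rw [edist_dist u v, huv]
  subst hu hv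
  refine le_antisymm (iSup_le fun d => ?_) ?_
  · rw [edist_dist]
    exact ENNReal.ofReal_le_ofReal (dist_raySeq_le_preDist d s t α β)
  · obtain ⟨d, hd⟩ := exists_preDist_le_dist_raySeq hω s t α β
    refine le_trans ?_ (InverseLimit.edist_val_le _ _ d)
    rw [edist_dist]
    exact ENNReal.ofReal_le_ofReal hd

end PsiEmbedding

theorem mainTheorem2 {X : Type*} [MetricSpace X] [ProperSpace X] [CAT0Space X]
    (hX : IsCocompactSpace X) (x₀ : X)
    (ω : Ultrafilter ℕ) (hω : (ω : Filter ℕ) ≤ Filter.cofinite) :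
    (∀ x y : ConeInverseLimit ω x₀, edist x y ≠ ⊤) ∧
    CompleteSpace (ConeInverseLimit ω x₀) ∧
    ∀ e : ℕ → BoundaryRay x₀,
      ∃ F : EuclideanCone (AngleUltraproduct ω e) → ConeInverseLimit ω x₀,
        (∀ (u : EuclideanCone (AngleUltraproduct ω e)) (d : ScalingSeq ω),
          (F u).val d = conePsi d u) ∧
        Isometry F := by
  exact ⟨ConeInverseLimit.edist_ne_top, ConeInverseLimit.completeSpace hω x₀, fun _ =>
    ⟨conePsiLimit, fun _ _ => rfl, isometry_conePsiLimit hω⟩⟩
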